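/- Write $(a;q^2)_\infty=\prod_{j\ge 0}(1-aq^{2j})$. Let $N2(m,n)$ be the number of partitions $\pi$ of $n$ with distinct odd parts whose $M_2$-rank $\lceil l(\pi)/2\rceil-\#(\pi)$ equals $m$, where $l(\pi)$ is the largest part ($0$ if $\pi$ is empty) and $\#(\pi)$ the number of parts of $\pi$. Let $M2(m,n)$ be the coefficients defined by $$\sum_{n\ge 0}\sum_{m\in\mathbb Z}M2(m,n)z^mq^n=\frac{(-q;q^2)_\infty\,(q^2;q^2)_\infty}{(zq^2;q^2)_\infty\,(z^{-1}q^2;q^2)_\infty}.$$ For $j\ge 0$ put $$\eta2_j(n)=\sum_{m\in\mathbb Z}\binom{m+\lfloor\frac{j-1}{2}\rfloor}{j}N2(m,n),\qquad \mu2_j(n)=\sum_{m\in\mathbb Z}\binom{m+\lfloor\frac{j-1}{2}\rfloor}{j}M2(m,n),$$ where $\binom{x}{j}=x(x-1)\cdots(x-j+1)/j!$, and for $k\ge 1$ put $\mathrm{M2spt}_k(n)=\mu2_{2k}(n)-\eta2_{2k}(n)$. Then for every $k\ge 1$, as formal power series in $q$, $$\sum_{n=1}^\infty \mathrm{M2spt}_k(n)\,q^n=\sum_{n_k\ge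 n_{k-1}\ge\dots\ge n_1\ge 1}\frac{q^{2n_1+2n_2+\dots+2n_k}}{(1-q^{2n_k})^2(1-q^{2n_{k-1}})^2\cdots(1-q^{2n_1})^2}\cdot\frac{(-q^{2n_1+1};q^2)_\infty}{(q^{2n_1+2};q^2)_\infty}.$$ Consequently $\mathrm{M2spt}_k(n)\ge 0$ for all $k\ge 1$ and all $n\ge 0$. -/

import Mathlib

open scoped PowerSeries LaurentPolynomial PowerSeries.WithPiTopology

noncomputable section

namespace M2Spt

/-- The infinite `q`-product `(a; q^2)_∞ = ∏_{j ≥ 0} (1 - a q^{2j})` in the ring `R⟦q⟧` of formal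
power series, with the usual coefficientwise convergence (`R` is discrete). The formal variable
`PowerSeries.X` is `q`. -/
def qPochInf {R : Type*} [CommRing R] (a : R⟦X⟧) : R⟦X⟧ :=
  letI : TopologicalSpace R := ⊥
  ∏' j : ℕ, (1 - a * PowerSeries.X ^ (2 * j))

/-- The multiplicative inverse of a formal power series with constant coefficient `1`. -/
def recip {R : Type*} [CommRing R] (f : R⟦X⟧) : R⟦X⟧ :=
  PowerSeries.invOfUnit f 1

/-- The odd parts of the partition are distinct. -/
def DistinctOddParts {n : ℕ} (p : n.Partition) : Prop :=
  ∀ i : ℕ, Odd i → p.parts.count i ≤ 1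

/-- The largest part of a partition (`0` for the empty partition). -/
def largestPart {n : ℕ} (p : n.Partition) : ℕ :=
  p.parts.sup

/-- The `M_2`-rank `⌈l(π) / 2⌉ - #(π)`. -/
def m2Rank {n : ℕ} (p : n.Partition) : ℤ :=
  ⌈(largestPart p : ℚ) / 2⌉ - (Multiset.card p.parts : ℤ)

/-- `N2(m, n)`: the number of partitions of `n` with distinct odd parts and `M_2`-rank `m`. -/
def N2 (m : ℤ) (n : ℕ) : ℤ :=
  (Nat.card {p : n.Partition // DistinctOddParts p ∧ m2Rank p = m} : ℤ)

/-- The two-variable residual crank series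
`(-q; q^2)_∞ (q^2; q^2)_∞ / ((z q^2; q^2)_∞ (z⁻¹ q^2; q^2)_∞)`,
a power series in `q` whose coefficients are Laurent polynomials in `z`. -/
def crankSeries : ℤ[T;T⁻¹]⟦X⟧ :=
  qPochInf (-PowerSeries.X) * qPochInf (PowerSeries.X ^ 2) *
    recip (qPochInf (PowerSeries.C (LaurentPolynomial.T 1) * PowerSeries.X ^ 2)) *
    recip (qPochInf (PowerSeries.C (LaurentPolynomial.T (-1)) * PowerSeries.X ^ 2))

/-- `M2(m, n)`: the coefficient of `z^m q^n` in the residual crank series. -/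
def M2 (m : ℤ) (n : ℕ) : ℤ :=
  (PowerSeries.coeff n crankSeries).coeff m

/-- The symmetrized moment `∑_{m ∈ ℤ} binom(m + ⌊(j - 1) / 2⌋, j) f(m)` of a finitely supported
function `f`, with the polynomial (generalized) binomial coefficient. -/
def symMoment (j : ℕ) (f : ℤ → ℤ) : ℤ :=
  ∑ᶠ m : ℤ, Ring.choose (m + ⌊((j : ℚ) - 1) / 2⌋) j * f m

/-- The symmetrized `M_2`-rank moment `η2_j(n)`. -/
def eta2 (j n : ℕ) : ℤ := symMoment j fun m => N2 m n

/-- The symmetrized residual crank moment `μ2_j(n)`. -/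
def mu2 (j n : ℕ) : ℤ := symMoment j fun m => M2 m n

/-- The higher order smallest parts function `M2spt_k(n) = μ2_{2k}(n) - η2_{2k}(n)`. -/
def M2spt (k n : ℕ) : ℤ := mu2 (2 * k) n - eta2 (2 * k) n

/-- The index set of the `k`-fold sum: `(n_1, …, n_k)` with `1 ≤ n_1 ≤ n_2 ≤ ⋯ ≤ n_k`; `n_i` is the
value at `i - 1`. -/
abbrev Index (k : ℕ) : Type :=
  {v : Fin k → ℕ // Monotone v ∧ ∀ i, 1 ≤ v i}

/-- The summand
`q^{2(n_1 + ⋯ + n_k)} / ∏_i (1 - q^{2 n_i})^2 * (-q^{2 n_1 + 1}; q^2)_∞ / (q^{2 n_1 + 2}; q^2)_∞`. -/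
def summand {k : ℕ} (hk : 1 ≤ k) (v : Index k) : ℤ⟦X⟧ :=
  PowerSeries.X ^ (2 * ∑ i, v.1 i) *
    recip (∏ i, (1 - PowerSeries.X ^ (2 * v.1 i)) ^ 2) *
    qPochInf (-PowerSeries.X ^ (2 * v.1 ⟨0, hk⟩ + 1)) *
    recip (qPochInf (PowerSeries.X ^ (2 * v.1 ⟨0, hk⟩ + 2)))

end M2Spt

end

noncomputable section

namespace M2Spt

open Filter Topology PowerSeries

section Algebra

variable {R : Type*} [CommRing R]

lemma mul_recip {f : R⟦X⟧} (h : constantCoeff f = 1) : f * recip f = 1 :=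
  mul_invOfUnit f 1 h

lemma recip_eq_of_mul_eq_one {f g : R⟦X⟧} (hf : constantCoeff f = 1) (h : f * g = 1) :
    recip f = g := by
  linear_combination (-recip f) * h + g * mul_recip hf

lemma recip_mul {f g : R⟦X⟧} (hf : constantCoeff f = 1) (hg : constantCoeff g = 1) :
    recip (f * g) = recip f * recip g := by
  refine recip_eq_of_mul_eq_one (by simp [hf, hg]) ?_
  linear_combination (f * recip f) * mul_recip hg + mul_recip hf

lemma recip_prod {ι : Type*} (s : Finset ι) {f : ι → R⟦X⟧} (hf : ∀ i, constantCoeff (f i) = 1) :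
    recip (∏ i ∈ s, f i) = ∏ i ∈ s, recip (f i) := by
  refine recip_eq_of_mul_eq_one (by simp [map_prod, hf]) ?_
  rw [← Finset.prod_mul_distrib]
  exact Finset.prod_eq_one fun i _ => mul_recip (hf i)

lemma eq_of_X_pow_dvd_sub {f g : R⟦X⟧} (h : ∀ n : ℕ, X ^ n ∣ f - g) : f = g := by
  rw [← sub_eq_zero]
  ext n
  exact X_pow_dvd_iff.1 (h (n + 1)) n (Nat.lt_succ_self n)

lemma constantCoeff_eq_of_X_dvd_sub {f g : R⟦X⟧} (h : X ∣ f - g) :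
    constantCoeff f = constantCoeff g := by
  rw [← sub_eq_zero, ← map_sub]
  exact X_dvd_iff.1 h

lemma le_order_of_X_pow_dvd {f : R⟦X⟧} {n : ℕ} (h : X ^ n ∣ f) : (n : ℕ∞) ≤ f.order :=
  nat_le_order f n (X_pow_dvd_iff.1 h)

lemma tendsto_order_of_X_pow_dvd {f : ℕ → R⟦X⟧} (h : ∀ n, X ^ n ∣ f n) :
    Tendsto (fun n => (f n).order) atTop (𝓝 ⊤) := by
  refine ENat.tendsto_nhds_top_iff_natCast_lt.mpr fun n => eventually_atTop.mpr ⟨n + 1, ?_⟩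
  intro m hm
  exact lt_of_lt_of_le (by exact_mod_cast hm) (le_order_of_X_pow_dvd (h m))

end Algebra

section Convergence

variable {R : Type*} [CommRing R] [TopologicalSpace R]

lemma isClosed_X_pow_dvd [T1Space R] (N : ℕ) : IsClosed {f : R⟦X⟧ | X ^ N ∣ f} := by
  simp only [X_pow_dvd_iff, Set.ofPred_forall]
  refine isClosed_iInter fun m => isClosed_iInter fun _ => ?_
  exact isClosed_singleton.preimage (WithPiTopology.continuous_coeff R m)

lemma X_pow_dvd_of_hasSum [T1Space R] {ι : Type*} {f : ι → R⟦X⟧} {s : R⟦X⟧} {N : ℕ}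
    (hs : HasSum f s) (h : ∀ i, X ^ N ∣ f i) : X ^ N ∣ s :=
  (isClosed_X_pow_dvd N).mem_of_tendsto hs <| Eventually.of_forall fun _ =>
    Finset.dvd_sum fun i _ => h i

lemma summable_of_X_pow_dvd {f : ℕ → R⟦X⟧} (h : ∀ n, X ^ n ∣ f n) : Summable f :=
  WithPiTopology.summable_of_tendsto_order_atTop_nhds_top R (tendsto_order_of_X_pow_dvd h)

lemma summable_of_finite_not_X_pow_dvd {ι : Type*} {f : ι → R⟦X⟧}
    (h : ∀ N : ℕ, {i | ¬ X ^ N ∣ f i}.Finite) : Summable f := by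
  rw [WithPiTopology.summable_iff_summable_coeff]
  intro d
  refine summable_of_hasFiniteSupport <| (h (d + 1)).subset fun i hi hd => hi ?_
  exact X_pow_dvd_iff.1 hd d (Nat.lt_succ_self d)

lemma tendsto_of_X_pow_dvd {f : ℕ → R⟦X⟧} {g : R⟦X⟧} (h : ∀ n, X ^ n ∣ f n - g) :
    Tendsto f atTop (𝓝 g) := by
  rw [WithPiTopology.tendsto_iff_coeff_tendsto]
  refine fun d => tendsto_atTop_of_eventually_const (i₀ := d + 1) fun n hn => ?_
  rw [← sub_eq_zero, ← map_sub]
  exact X_pow_dvd_iff.1 (h n) d hn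

lemma multipliable_qPochInf (a : R⟦X⟧) : Multipliable fun j : ℕ => 1 - a * X ^ (2 * j) := by
  simp only [sub_eq_add_neg]
  refine WithPiTopology.multipliable_one_add_of_tendsto_order_atTop_nhds_top R
    (tendsto_order_of_X_pow_dvd fun n => ?_)
  exact (dvd_neg).2 (Dvd.dvd.mul_left (pow_dvd_pow _ (by omega)) _)

variable [DiscreteTopology R]

lemma qPochInf_eq_tprod (a : R⟦X⟧) : qPochInf a = ∏' j : ℕ, (1 - a * X ^ (2 * j)) := by
  obtain rfl := DiscreteTopology.eq_bot (α := R)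
  rfl

lemma hasProd_qPochInf (a : R⟦X⟧) : HasProd (fun j : ℕ => 1 - a * X ^ (2 * j)) (qPochInf a) :=
  qPochInf_eq_tprod a ▸ (multipliable_qPochInf a).hasProd

end Convergence

section QPochhammer

variable {R : Type*} [CommRing R]

lemma qPochInf_eq_mul (a : R⟦X⟧) : qPochInf a = (1 - a) * qPochInf (a * X ^ 2) := by
  let _ : TopologicalSpace R := ⊥
  have _ : DiscreteTopology R := ⟨rfl⟩
  rw [qPochInf_eq_tprod, qPochInf_eq_tprod, tprod_eq_zero_mul']
  · rw [mul_zero, pow_zero, mul_one]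
    exact congrArg _ (tprod_congr fun j => by ring)
  · convert multipliable_qPochInf (a * X ^ 2) using 2 with j
    ring

lemma qPochInf_eq_prod_mul (a : R⟦X⟧) (n : ℕ) :
    qPochInf a = (∏ j ∈ Finset.range n, (1 - a * X ^ (2 * j))) * qPochInf (a * X ^ (2 * n)) := by
  induction n with
  | zero => simp
  | succ n ih =>
    rw [ih, Finset.prod_range_succ, qPochInf_eq_mul (a * X ^ (2 * n))]
    ring_nf

lemma X_pow_dvd_prod_sub_one {ι : Type*} {f : ι → R⟦X⟧} {N : ℕ} (h : ∀ i, X ^ N ∣ f i - 1)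
    (s : Finset ι) : X ^ N ∣ (∏ i ∈ s, f i) - 1 := by
  classical
  induction s using Finset.induction_on with
  | empty => simp
  | insert i s hi ih =>
    rw [Finset.prod_insert hi,
      show f i * ∏ j ∈ s, f j - 1 = (f i - 1) * ∏ j ∈ s, f j + (∏ j ∈ s, f j - 1) by ring]
    exact dvd_add (Dvd.dvd.mul_right (h i) _) ih

lemma X_pow_dvd_qPochInf_sub_one {a : R⟦X⟧} {N : ℕ} (h : X ^ N ∣ a) :
    X ^ N ∣ qPochInf a - 1 := by
  let _ : TopologicalSpace R := ⊥
  have _ : DiscreteTopology R := ⟨rfl⟩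
  refine (isClosed_X_pow_dvd N).mem_of_tendsto ((hasProd_qPochInf a).sub_const 1)
    (Eventually.of_forall fun s => X_pow_dvd_prod_sub_one (fun j => ?_) s)
  rw [sub_sub_cancel_left, dvd_neg]
  exact Dvd.dvd.mul_right h _

lemma constantCoeff_qPochInf {a : R⟦X⟧} (h : X ∣ a) : constantCoeff (qPochInf a) = 1 := by
  rw [← map_one (constantCoeff (R := R))]
  exact constantCoeff_eq_of_X_dvd_sub (by simpa using X_pow_dvd_qPochInf_sub_one (N := 1) (by simpa))

lemma map_qPochInf {S : Type*} [CommRing S] (φ : R →+* S) (a : R⟦X⟧) :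
    PowerSeries.map φ (qPochInf a) = qPochInf (PowerSeries.map φ a) := by
  refine eq_of_X_pow_dvd_sub fun n => ?_
  rw [qPochInf_eq_prod_mul a n, qPochInf_eq_prod_mul (PowerSeries.map φ a) n]
  obtain ⟨c, hc⟩ := X_pow_dvd_qPochInf_sub_one (N := n) (a := a * X ^ (2 * n))
    (Dvd.dvd.mul_left (pow_dvd_pow _ (by omega)) _)
  obtain ⟨d, hd⟩ := X_pow_dvd_qPochInf_sub_one (N := n) (a := PowerSeries.map φ a * X ^ (2 * n))
    (Dvd.dvd.mul_left (pow_dvd_pow _ (by omega)) _)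
  rw [eq_add_of_sub_eq hc, eq_add_of_sub_eq hd]
  simp only [map_mul, map_add, map_pow, map_prod, map_sub, map_one, PowerSeries.map_X]
  exact ⟨(∏ j ∈ Finset.range n, (1 - PowerSeries.map φ a * X ^ (2 * j))) *
    (PowerSeries.map φ c - d), by ring⟩

lemma map_recip {S : Type*} [CommRing S] (φ : R →+* S) {f : R⟦X⟧} (hf : constantCoeff f = 1) :
    PowerSeries.map φ (recip f) = recip (PowerSeries.map φ f) := by
  refine (recip_eq_of_mul_eq_one ?_ ?_).symm
  · rw [← coeff_zero_eq_constantCoeff_apply, coeff_map, coeff_zero_eq_constantCoeff_apply, hf,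
      map_one]
  · rw [← map_mul, mul_recip hf, map_one]

end QPochhammer

section QBinomial

variable {R : Type*} [CommRing R]

/-- The summand `∏_{j < m} (x - y q^{2j}) / (1 - q^{2j+2})` of the `q`-binomial series. -/
def qBinomialTerm (x y : R⟦X⟧) (m : ℕ) : R⟦X⟧ :=
  ∏ j ∈ Finset.range m, ((x - y * X ^ (2 * j)) * recip (1 - X ^ (2 * (j + 1))))

lemma constantCoeff_one_sub {a : R⟦X⟧} (h : X ∣ a) : constantCoeff (1 - a) = 1 := by
  simp [X_dvd_iff.1 h]

lemma X_dvd_X_pow {n : ℕ} (hn : n ≠ 0) : (X : R⟦X⟧) ∣ X ^ n := dvd_pow_self _ hn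

lemma qBinomialTerm_scale (x y : R⟦X⟧) (m : ℕ) :
    qBinomialTerm (x * X ^ 2) (y * X ^ 2) m = X ^ (2 * m) * qBinomialTerm x y m := by
  simp only [qBinomialTerm]
  induction m with
  | zero => simp
  | succ m ih =>
    rw [Finset.prod_range_succ, Finset.prod_range_succ, ih]
    ring

lemma one_sub_mul_qBinomialTerm_succ (x y : R⟦X⟧) (m : ℕ) :
    (1 - X ^ (2 * (m + 1))) * qBinomialTerm x y (m + 1) =
      (x - y * X ^ (2 * m)) * qBinomialTerm x y m := by
  have h := mul_recip (constantCoeff_one_sub (X_dvd_X_pow (R := R) (n := 2 * (m + 1)) (by omega)))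
  rw [qBinomialTerm, Finset.prod_range_succ, ← qBinomialTerm]
  linear_combination (qBinomialTerm x y m * (x - y * X ^ (2 * m))) * h

lemma X_pow_dvd_qBinomialTerm {x y : R⟦X⟧} {N : ℕ} (hx : X ^ N ∣ x) (hy : X ^ N ∣ y) (m : ℕ) :
    X ^ (N * m) ∣ qBinomialTerm x y m := by
  have h : X ^ (N * m) = ∏ _j ∈ Finset.range m, (X : R⟦X⟧) ^ N := by simp [pow_mul]
  rw [h]
  exact Finset.prod_dvd_prod_of_dvd _ _ fun j _ =>
    Dvd.dvd.mul_right (dvd_sub hx (Dvd.dvd.mul_right hy _)) _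

variable [TopologicalSpace R]

lemma summable_qBinomialTerm {x y : R⟦X⟧} (hx : X ∣ x) (hy : X ∣ y) :
    Summable (qBinomialTerm x y) :=
  summable_of_X_pow_dvd fun n => by
    simpa using X_pow_dvd_qBinomialTerm (N := 1) (by simpa using hx) (by simpa using hy) n

variable [DiscreteTopology R]

lemma one_sub_mul_tsum_qBinomialTerm {x y : R⟦X⟧} (hx : X ∣ x) (hy : X ∣ y) :
    (1 - x) * ∑' m, qBinomialTerm x y m =
      (1 - y) * ∑' m, qBinomialTerm (x * X ^ 2) (y * X ^ 2) m := by
  have hs := summable_qBinomialTerm hx hy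
  have hs' := summable_qBinomialTerm (Dvd.dvd.mul_right hx (X ^ 2)) (Dvd.dvd.mul_right hy (X ^ 2))
  have h1 : (∑' m, qBinomialTerm x y m) - ∑' m, qBinomialTerm (x * X ^ 2) (y * X ^ 2) m =
      x * (∑' m, qBinomialTerm x y m) -
        y * ∑' m, qBinomialTerm (x * X ^ 2) (y * X ^ 2) m := by
    rw [← hs.tsum_sub hs', ← hs.tsum_mul_left, ← hs'.tsum_mul_left,
      ← (hs.mul_left x).tsum_sub (hs'.mul_left y), (hs.sub hs').tsum_eq_zero_add]
    have h0 : qBinomialTerm x y 0 - qBinomialTerm (x * X ^ 2) (y * X ^ 2) 0 = 0 := by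
      simp [qBinomialTerm]
    rw [h0, zero_add]
    refine tsum_congr fun m => ?_
    rw [qBinomialTerm_scale, qBinomialTerm_scale]
    linear_combination one_sub_mul_qBinomialTerm_succ x y m
  linear_combination h1

lemma X_pow_dvd_tsum_qBinomialTerm_sub_one {x y : R⟦X⟧} {N : ℕ} (hN : N ≠ 0) (hx : X ^ N ∣ x)
    (hy : X ^ N ∣ y) : X ^ N ∣ (∑' m, qBinomialTerm x y m) - 1 := by
  have hs := summable_qBinomialTerm ((X_dvd_X_pow hN).trans hx) ((X_dvd_X_pow hN).trans hy)
  rw [hs.tsum_eq_zero_add, show qBinomialTerm x y 0 = 1 by simp [qBinomialTerm],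
    add_sub_cancel_left]
  exact X_pow_dvd_of_hasSum ((summable_nat_add_iff 1).2 hs).hasSum fun m =>
    (pow_dvd_pow _ (Nat.le_mul_of_pos_right N (Nat.succ_pos m))).trans
      (X_pow_dvd_qBinomialTerm hx hy (m + 1))

/-- The `q`-binomial theorem in homogeneous form. -/
theorem hasSum_qBinomialTerm {x y : R⟦X⟧} (hx : X ∣ x) (hy : X ∣ y) :
    HasSum (qBinomialTerm x y) (qPochInf y * recip (qPochInf x)) := by
  set V : ℕ → R⟦X⟧ := fun N => qPochInf (x * X ^ (2 * N)) *
    ∑' m, qBinomialTerm (x * X ^ (2 * N)) (y * X ^ (2 * N)) m with hV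
  have step : ∀ N, V N = (1 - y * X ^ (2 * N)) * V (N + 1) := by
    intro N
    have h := one_sub_mul_tsum_qBinomialTerm (Dvd.dvd.mul_right hx (X ^ (2 * N)))
      (Dvd.dvd.mul_right hy (X ^ (2 * N)))
    have e : ∀ a : R⟦X⟧, a * X ^ (2 * N) * X ^ 2 = a * X ^ (2 * (N + 1)) := fun a => by ring
    simp only [hV]
    rw [qPochInf_eq_mul (x * X ^ (2 * N))]
    simp only [e] at h ⊢
    linear_combination qPochInf (x * X ^ (2 * (N + 1))) * h
  have iter : ∀ N, V 0 = (∏ j ∈ Finset.range N, (1 - y * X ^ (2 * j))) * V N := by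
    intro N
    induction N with
    | zero => simp
    | succ N ih => rw [ih, Finset.prod_range_succ, step N, mul_assoc]
  have h0 : V 0 = qPochInf y := by
    refine eq_of_X_pow_dvd_sub fun n => ?_
    rw [iter (n + 1), qPochInf_eq_prod_mul y (n + 1), ← mul_sub]
    refine Dvd.dvd.mul_left ((pow_dvd_pow X (show n ≤ n + 1 by omega)).trans ?_) _
    have hd : ∀ a : R⟦X⟧, X ^ (n + 1) ∣ a * X ^ (2 * (n + 1)) := fun a =>
      Dvd.dvd.mul_left (pow_dvd_pow _ (by omega)) _
    obtain ⟨a, ha⟩ := X_pow_dvd_qPochInf_sub_one (hd x)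
    obtain ⟨b, hb⟩ := X_pow_dvd_qPochInf_sub_one (hd y)
    obtain ⟨c, hc⟩ := X_pow_dvd_tsum_qBinomialTerm_sub_one (N := n + 1) (by omega) (hd x) (hd y)
    refine ⟨a * (1 + X ^ (n + 1) * c) + c - b, ?_⟩
    simp only [hV]
    rw [eq_add_of_sub_eq ha, eq_add_of_sub_eq hb, eq_add_of_sub_eq hc]
    ring
  have h1 : ∑' m, qBinomialTerm x y m = qPochInf y * recip (qPochInf x) := by
    rw [← h0]
    simp only [hV, mul_zero, pow_zero, mul_one]
    linear_combination (-∑' m, qBinomialTerm x y m) * mul_recip (constantCoeff_qPochInf hx)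
  exact h1 ▸ (summable_qBinomialTerm hx hy).hasSum

end QBinomial

section Heine

variable {R : Type*} [CommRing R]

/-- The quotient `(q^{2n}; q^2)_∞^2 / ((z q^{2n}; q^2)_∞ (w q^{2n}; q^2)_∞)`. -/
def crankTail (z w : R) (n : ℕ) : R⟦X⟧ :=
  qPochInf (X ^ (2 * n)) ^ 2 * recip (qPochInf (C z * X ^ (2 * n))) *
    recip (qPochInf (C w * X ^ (2 * n)))

variable (R) in
/-- The quotient `(-q^{2n+1}; q^2)_∞ / (q^{2n+2}; q^2)_∞`. -/
def partTail (n : ℕ) : R⟦X⟧ :=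
  qPochInf (-X ^ (2 * n + 1)) * recip (qPochInf (X ^ (2 * n + 2)))

/-- The summand `z^n q^{2n+1} (1 + q) (-q/z; q^2)_n / (w q^2; q^2)_{n+1}`, with `z^n` absorbed into
the Pochhammer symbol in the numerator. -/
def rankTerm (z w : R) (n : ℕ) : R⟦X⟧ :=
  X ^ (2 * n + 1) * (1 + X) * (∏ j ∈ Finset.range n, (C z + X ^ (2 * j + 1))) *
    recip (∏ j ∈ Finset.range (n + 1), (1 - C w * X ^ (2 * (j + 1))))

lemma X_dvd_mul_X_pow (a : R⟦X⟧) {n : ℕ} (hn : n ≠ 0) : X ∣ a * X ^ n :=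
  Dvd.dvd.mul_left (X_dvd_X_pow hn) a

lemma constantCoeff_prod_one_sub {ι : Type*} (s : Finset ι) {f : ι → R⟦X⟧} (hf : ∀ i, X ∣ f i) :
    constantCoeff (∏ i ∈ s, (1 - f i)) = 1 := by
  rw [map_prod]
  exact Finset.prod_eq_one fun i _ => constantCoeff_one_sub (hf i)

lemma qPochInf_mul_X_sq (a : R⟦X⟧) (n : ℕ) :
    qPochInf (a * X ^ 2) =
      (∏ j ∈ Finset.range n, (1 - a * X ^ (2 * (j + 1)))) * qPochInf (a * X ^ (2 * (n + 1))) := by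
  rw [qPochInf_eq_prod_mul (a * X ^ 2) n]
  congr 1
  · exact Finset.prod_congr rfl fun j _ => by ring
  · congr 1; ring

/-- The summand of the double series behind Heine's transformation. -/
def heineTerm (z w : R) (n m : ℕ) : R⟦X⟧ :=
  X * (1 + X) * qPochInf (X ^ 2) * recip (qPochInf (C w * X ^ 2)) *
    (X ^ (2 * n + 2 * m + 2 * n * m)) *
    (∏ j ∈ Finset.range m, (1 - C w * X ^ (2 * (j + 1))) * recip (1 - X ^ (2 * (j + 1)))) *
    ∏ j ∈ Finset.range n, (C z + X ^ (2 * j + 1)) * recip (1 - X ^ (2 * (j + 1)))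

lemma heineTerm_eq_mul_left (z w : R) (n m : ℕ) :
    heineTerm z w n m = X * (1 + X) * qPochInf (X ^ 2) * recip (qPochInf (C w * X ^ 2)) *
      X ^ (2 * n) *
      (∏ j ∈ Finset.range n, (C z + X ^ (2 * j + 1)) * recip (1 - X ^ (2 * (j + 1)))) *
      qBinomialTerm (X ^ (2 * (n + 1))) (C w * X ^ (2 * (n + 2))) m := by
  have h : qBinomialTerm (X ^ (2 * (n + 1))) (C w * X ^ (2 * (n + 2))) m =
      X ^ (2 * m + 2 * n * m) *
        ∏ j ∈ Finset.range m, (1 - C w * X ^ (2 * (j + 1))) * recip (1 - X ^ (2 * (j + 1))) := by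
    rw [qBinomialTerm]
    induction m with
    | zero => simp
    | succ m ih =>
      rw [Finset.prod_range_succ, Finset.prod_range_succ, ih]
      ring
  rw [h, heineTerm]
  ring

lemma heineTerm_eq_mul_right (z w : R) (n m : ℕ) :
    heineTerm z w n m = X * (1 + X) * qPochInf (X ^ 2) * recip (qPochInf (C w * X ^ 2)) *
      X ^ (2 * m) *
      (∏ j ∈ Finset.range m, (1 - C w * X ^ (2 * (j + 1))) * recip (1 - X ^ (2 * (j + 1)))) *
      qBinomialTerm (C z * X ^ (2 * (m + 1))) (-X ^ (2 * (m + 1) + 1)) n := by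
  have h : qBinomialTerm (C z * X ^ (2 * (m + 1))) (-X ^ (2 * (m + 1) + 1)) n =
      X ^ (2 * n + 2 * n * m) *
        ∏ j ∈ Finset.range n, (C z + X ^ (2 * j + 1)) * recip (1 - X ^ (2 * (j + 1))) := by
    rw [qBinomialTerm]
    induction n with
    | zero => simp
    | succ n ih =>
      rw [Finset.prod_range_succ, Finset.prod_range_succ, ih]
      ring
  rw [h, heineTerm]
  ring

lemma constantCoeff_qPochInf_X_pow {n : ℕ} (hn : n ≠ 0) :
    constantCoeff (qPochInf (X ^ n : R⟦X⟧)) = 1 :=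
  constantCoeff_qPochInf (X_dvd_X_pow hn)

lemma constantCoeff_qPochInf_mul_X_pow (a : R⟦X⟧) {n : ℕ} (hn : n ≠ 0) :
    constantCoeff (qPochInf (a * X ^ n)) = 1 :=
  constantCoeff_qPochInf (X_dvd_mul_X_pow a hn)

lemma prod_mul_recip_one_sub (f : ℕ → R⟦X⟧) (n : ℕ) :
    ∏ j ∈ Finset.range n, f j * recip (1 - X ^ (2 * (j + 1))) =
      (∏ j ∈ Finset.range n, f j) * recip (∏ j ∈ Finset.range n, (1 - X ^ (2 * (j + 1)))) := by
  rw [Finset.prod_mul_distrib, recip_prod]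
  exact fun i => constantCoeff_one_sub (X_dvd_X_pow (by omega))

lemma heineTerm_row_value (z w : R) (n : ℕ) :
    X * (1 + X) * qPochInf (X ^ 2) * recip (qPochInf (C w * X ^ 2)) * X ^ (2 * n) *
      (∏ j ∈ Finset.range n, (C z + X ^ (2 * j + 1)) * recip (1 - X ^ (2 * (j + 1)))) *
      (qPochInf (C w * X ^ (2 * (n + 2))) * recip (qPochInf (X ^ (2 * (n + 1))))) =
    rankTerm z w n := by
  have hQ : qPochInf (X ^ 2 : R⟦X⟧) =
      (∏ j ∈ Finset.range n, (1 - X ^ (2 * (j + 1)))) * qPochInf (X ^ (2 * (n + 1))) := by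
    simpa using qPochInf_mul_X_sq (1 : R⟦X⟧) n
  have hw := qPochInf_mul_X_sq (C w) (n + 1)
  have h1 := mul_recip (constantCoeff_qPochInf_X_pow (R := R) (n := 2 * (n + 1)) (by omega))
  have h2 := mul_recip (constantCoeff_qPochInf_mul_X_pow (C w) (n := 2 * (n + 2)) (by omega))
  have h3 := mul_recip (constantCoeff_prod_one_sub (Finset.range n)
    (f := fun j => (X : R⟦X⟧) ^ (2 * (j + 1))) fun j => X_dvd_X_pow (by omega))
  rw [prod_mul_recip_one_sub, hQ, hw, recip_mul
    (constantCoeff_prod_one_sub _ fun j => X_dvd_mul_X_pow _ (by omega))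
    (constantCoeff_qPochInf_mul_X_pow _ (by omega)), rankTerm]
  set e1 := qPochInf (X ^ (2 * (n + 1)) : R⟦X⟧)
  set e2 := qPochInf (C w * X ^ (2 * (n + 2)))
  set e3 := ∏ j ∈ Finset.range n, (1 - (X : R⟦X⟧) ^ (2 * (j + 1)))
  set p := ∏ j ∈ Finset.range n, (C z + X ^ (2 * j + 1))
  set r := recip (∏ j ∈ Finset.range (n + 1), (1 - C w * X ^ (2 * (j + 1))))
  calc _ = X ^ (2 * n + 1) * (1 + X) * p * r * (e1 * recip e1) * (e2 * recip e2) *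
        (e3 * recip e3) := by ring
    _ = _ := by rw [h1, h2, h3]; ring

lemma partTail_sub_partTail_succ (n : ℕ) :
    partTail R n - partTail R (n + 1) =
      X ^ (2 * n + 1) * (1 + X) * qPochInf (-X ^ (2 * (n + 1) + 1)) *
        recip (qPochInf (X ^ (2 * (n + 1)))) := by
  have ha : qPochInf (-X ^ (2 * n + 1) : R⟦X⟧) =
      (1 + X ^ (2 * n + 1)) * qPochInf (-X ^ (2 * (n + 1) + 1)) := by
    rw [qPochInf_eq_mul, sub_neg_eq_add]
    ring_nf
  have hb : qPochInf (X ^ (2 * (n + 1)) : R⟦X⟧) =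
      (1 - X ^ (2 * (n + 1))) * qPochInf (X ^ (2 * (n + 1) + 2)) := by
    rw [qPochInf_eq_mul]
    ring_nf
  have h1 := mul_recip (constantCoeff_one_sub (X_dvd_X_pow (R := R) (n := 2 * (n + 1)) (by omega)))
  have h : recip (qPochInf (X ^ (2 * (n + 1) + 2) : R⟦X⟧)) =
      (1 - X ^ (2 * (n + 1))) * recip (qPochInf (X ^ (2 * (n + 1)))) := by
    rw [hb, recip_mul (constantCoeff_one_sub (X_dvd_X_pow (by omega)))
      (constantCoeff_qPochInf_X_pow (by omega))]
    linear_combination (-recip (qPochInf (X ^ (2 * (n + 1) + 2) : R⟦X⟧))) * h1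
  rw [partTail, partTail, ha, h, show 2 * n + 2 = 2 * (n + 1) by ring]
  ring

lemma heineTerm_column_value (z w : R) (m : ℕ) :
    X * (1 + X) * qPochInf (X ^ 2) * recip (qPochInf (C w * X ^ 2)) * X ^ (2 * m) *
      (∏ j ∈ Finset.range m, (1 - C w * X ^ (2 * (j + 1))) * recip (1 - X ^ (2 * (j + 1)))) *
      (qPochInf (-X ^ (2 * (m + 1) + 1)) * recip (qPochInf (C z * X ^ (2 * (m + 1))))) =
    crankTail z w (m + 1) * (partTail R m - partTail R (m + 1)) := by
  have hQ : qPochInf (X ^ 2 : R⟦X⟧) =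
      (∏ j ∈ Finset.range m, (1 - X ^ (2 * (j + 1)))) * qPochInf (X ^ (2 * (m + 1))) := by
    simpa using qPochInf_mul_X_sq (1 : R⟦X⟧) m
  have hw := qPochInf_mul_X_sq (C w) m
  have h1 := mul_recip (constantCoeff_qPochInf_X_pow (R := R) (n := 2 * (m + 1)) (by omega))
  have h2 := mul_recip (constantCoeff_prod_one_sub (Finset.range m)
    (f := fun j => C w * (X : R⟦X⟧) ^ (2 * (j + 1))) fun j => X_dvd_mul_X_pow _ (by omega))
  have h3 := mul_recip (constantCoeff_prod_one_sub (Finset.range m)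
    (f := fun j => (X : R⟦X⟧) ^ (2 * (j + 1))) fun j => X_dvd_X_pow (by omega))
  rw [prod_mul_recip_one_sub, hQ, hw, recip_mul
    (constantCoeff_prod_one_sub _ fun j => X_dvd_mul_X_pow _ (by omega))
    (constantCoeff_qPochInf_mul_X_pow _ (by omega)), partTail_sub_partTail_succ, crankTail]
  set e1 := qPochInf (X ^ (2 * (m + 1)) : R⟦X⟧)
  set e2 := ∏ j ∈ Finset.range m, (1 - C w * (X : R⟦X⟧) ^ (2 * (j + 1)))
  set e3 := ∏ j ∈ Finset.range m, (1 - (X : R⟦X⟧) ^ (2 * (j + 1)))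
  set f := qPochInf (-X ^ (2 * (m + 1) + 1) : R⟦X⟧)
  set rz := recip (qPochInf (C z * X ^ (2 * (m + 1))))
  set rw' := recip (qPochInf (C w * X ^ (2 * (m + 1))))
  calc _ = X ^ (2 * m + 1) * (1 + X) * f * rz * rw' * e1 * (e2 * recip e2) *
        (e3 * recip e3) := by ring
    _ = X ^ (2 * m + 1) * (1 + X) * f * rz * rw' * e1 * (e1 * recip e1) := by
      rw [h1, h2, h3]; ring
    _ = _ := by ring

variable [TopologicalSpace R]

lemma summable_heineTerm (z w : R) : Summable fun p : ℕ × ℕ => heineTerm z w p.1 p.2 := by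
  refine summable_of_finite_not_X_pow_dvd fun N =>
    ((Finset.range N ×ˢ Finset.range N).finite_toSet).subset fun p hp => ?_
  by_contra h
  refine hp ?_
  simp only [Finset.coe_product, Finset.coe_range, Set.mem_prod, Set.mem_Iio, not_and_or,
    not_lt] at h
  have : N ≤ 2 * p.1 + 2 * p.2 + 2 * p.1 * p.2 := by
    have := Nat.zero_le (2 * p.1 * p.2)
    omega
  rw [heineTerm]
  exact Dvd.dvd.mul_right (Dvd.dvd.mul_right (Dvd.dvd.mul_left (pow_dvd_pow X this) _) _) _

variable [DiscreteTopology R]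

/-- The case of Heine's transformation that relates the rank series to the tails of the crank
series. -/
theorem tsum_rankTerm (z w : R) :
    ∑' n, rankTerm z w n =
      ∑' m, crankTail z w (m + 1) * (partTail R m - partTail R (m + 1)) := by
  have hr : ∀ n, HasSum (fun m => heineTerm z w n m) (rankTerm z w n) := fun n => by
    have h := (hasSum_qBinomialTerm (X_dvd_X_pow (R := R) (n := 2 * (n + 1)) (by omega))
      (X_dvd_mul_X_pow (C w) (n := 2 * (n + 2)) (by omega))).mul_left
      (X * (1 + X) * qPochInf (X ^ 2) * recip (qPochInf (C w * X ^ 2)) * X ^ (2 * n) *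
        ∏ j ∈ Finset.range n, (C z + X ^ (2 * j + 1)) * recip (1 - X ^ (2 * (j + 1))))
    rw [heineTerm_row_value] at h
    simpa only [heineTerm_eq_mul_left] using h
  have hc : ∀ m, HasSum (fun n => heineTerm z w n m)
      (crankTail z w (m + 1) * (partTail R m - partTail R (m + 1))) := fun m => by
    have h := (hasSum_qBinomialTerm (X_dvd_mul_X_pow (C z) (n := 2 * (m + 1)) (by omega))
      ((dvd_neg).2 (X_dvd_X_pow (R := R) (n := 2 * (m + 1) + 1) (by omega)))).mul_left
      (X * (1 + X) * qPochInf (X ^ 2) * recip (qPochInf (C w * X ^ 2)) * X ^ (2 * m) *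
        ∏ j ∈ Finset.range m, (1 - C w * X ^ (2 * (j + 1))) * recip (1 - X ^ (2 * (j + 1))))
    rw [heineTerm_column_value] at h
    simpa only [heineTerm_eq_mul_right] using h
  have hs := (summable_heineTerm z w).hasSum
  have h1 := HasSum.prod_fiberwise hs hr
  have h2 := HasSum.prod_fiberwise ((Equiv.prodComm ℕ ℕ).hasSum_iff.2 hs) hc
  exact h1.tsum_eq.trans h2.tsum_eq.symm

end Heine

section Abel

variable {R : Type*} [CommRing R]

lemma X_pow_dvd_mul_sub_one {f g : R⟦X⟧} {N : ℕ} (hf : X ^ N ∣ f - 1) (hg : X ^ N ∣ g - 1) :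
    X ^ N ∣ f * g - 1 := by
  rw [show f * g - 1 = (f - 1) * g + (g - 1) by ring]
  exact dvd_add (Dvd.dvd.mul_right hf _) hg

lemma X_pow_dvd_recip_sub_one {f : R⟦X⟧} {N : ℕ} (hc : constantCoeff f = 1)
    (hf : X ^ N ∣ f - 1) : X ^ N ∣ recip f - 1 := by
  rw [show recip f - 1 = -((f - 1) * recip f) by linear_combination mul_recip hc]
  exact (dvd_neg).2 (Dvd.dvd.mul_right hf _)

lemma X_pow_dvd_crankTail_sub_one (z w : R) {n : ℕ} (hn : n ≠ 0) :
    X ^ n ∣ crankTail z w n - 1 := by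
  have h : ∀ a : R⟦X⟧, X ^ n ∣ a * X ^ (2 * n) := fun a =>
    Dvd.dvd.mul_left (pow_dvd_pow _ (by omega)) a
  have h1 := X_pow_dvd_qPochInf_sub_one (by simpa using h 1)
  rw [crankTail, sq]
  exact X_pow_dvd_mul_sub_one (X_pow_dvd_mul_sub_one (X_pow_dvd_mul_sub_one h1 h1)
    (X_pow_dvd_recip_sub_one (constantCoeff_qPochInf_mul_X_pow _ (by omega))
      (X_pow_dvd_qPochInf_sub_one (h _))))
    (X_pow_dvd_recip_sub_one (constantCoeff_qPochInf_mul_X_pow _ (by omega))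
      (X_pow_dvd_qPochInf_sub_one (h _)))

lemma X_pow_dvd_partTail_sub_one (n : ℕ) : X ^ n ∣ partTail R n - 1 :=
  X_pow_dvd_mul_sub_one
    (X_pow_dvd_qPochInf_sub_one ((dvd_neg).2 (pow_dvd_pow _ (by omega))))
    (X_pow_dvd_recip_sub_one (constantCoeff_qPochInf_X_pow (by omega))
      (X_pow_dvd_qPochInf_sub_one (pow_dvd_pow _ (by omega))))

/-- `q^{2n} / (1 - q^{2n})^2`. -/
def squareTerm (R : Type*) [CommRing R] (n : ℕ) : R⟦X⟧ :=
  X ^ (2 * n) * recip ((1 - X ^ (2 * n)) ^ 2)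

lemma crankTail_eq_add {z w : R} (hzw : z * w = 1) {n : ℕ} (hn : n ≠ 0) :
    crankTail z w n =
      crankTail z w (n + 1) + C (z + w - 2) * squareTerm R n * crankTail z w n := by
  have e : ∀ a : R⟦X⟧, qPochInf (a * X ^ (2 * n)) =
      (1 - a * X ^ (2 * n)) * qPochInf (a * X ^ (2 * (n + 1))) := fun a => by
    rw [qPochInf_eq_mul]; ring_nf
  have hc : ∀ a : R⟦X⟧, constantCoeff (1 - a * X ^ (2 * n)) = 1 := fun a =>
    constantCoeff_one_sub (X_dvd_mul_X_pow a (by omega))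
  have hE : ∀ a : R⟦X⟧, constantCoeff (qPochInf (a * X ^ (2 * (n + 1)))) = 1 := fun a =>
    constantCoeff_qPochInf_mul_X_pow a (by omega)
  have e1 : qPochInf (X ^ (2 * n) : R⟦X⟧) = (1 - X ^ (2 * n)) * qPochInf (X ^ (2 * (n + 1))) := by
    simpa using e 1
  have hz := mul_recip (hc (C z))
  have hw := mul_recip (hc (C w))
  have h1 : (1 - X ^ (2 * n)) ^ 2 * recip ((1 - X ^ (2 * n) : R⟦X⟧) ^ 2) = 1 :=
    mul_recip (by
      rw [map_pow, constantCoeff_one_sub (X_dvd_X_pow (by omega)), one_pow])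
  have hC : (C z : R⟦X⟧) * C w = 1 := by rw [← map_mul, hzw, map_one]
  rw [squareTerm, crankTail, crankTail, e1, e, e, recip_mul (hc _) (hE _),
    recip_mul (hc _) (hE _)]
  simp only [map_sub, map_add, map_ofNat]
  set F := qPochInf (X ^ (2 * (n + 1)) : R⟦X⟧)
  set rz := recip (qPochInf (C z * X ^ (2 * (n + 1))))
  set rw' := recip (qPochInf (C w * X ^ (2 * (n + 1))))
  set x := (X : R⟦X⟧) ^ (2 * n)
  set sz := recip (1 - C z * x)
  set sw := recip (1 - C w * x)
  set s := recip ((1 - x) ^ 2)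
  have key : (1 - x) ^ 2 * sz * sw = 1 + (C z + C w - 2) * x * sz * sw := by
    linear_combination sz * (1 - C z * x) * hw + hz - sz * sw * x ^ 2 * hC
  linear_combination F ^ 2 * rz * rw' * key -
    F ^ 2 * rz * rw' * (C z + C w - 2) * x * sz * sw * h1

variable [TopologicalSpace R] [DiscreteTopology R]

/-- The residual crank series minus the rank series, as a single series. -/
theorem hasSum_crank_sub_rank {z w : R} (hzw : z * w = 1) :
    HasSum (fun n => C (z + w - 2) * squareTerm R (n + 1) * crankTail z w (n + 1) *
        partTail R (n + 1))
      (crankTail z w 1 * partTail R 0 - (1 + ∑' n, rankTerm z w n)) := by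
  have hd : ∀ n, X ^ n ∣ crankTail z w (n + 1) * partTail R n - 1 := fun n =>
    X_pow_dvd_mul_sub_one ((pow_dvd_pow X (Nat.le_succ n)).trans
      (X_pow_dvd_crankTail_sub_one z w (Nat.succ_ne_zero n))) (X_pow_dvd_partTail_sub_one n)
  have ht := tendsto_of_X_pow_dvd hd
  have s1 : Summable fun n => crankTail z w (n + 1) * partTail R n -
      crankTail z w (n + 1 + 1) * partTail R (n + 1) := by
    refine summable_of_X_pow_dvd fun n => ?_
    have := dvd_sub (hd n) ((pow_dvd_pow X (Nat.le_succ n)).trans (hd (n + 1)))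
    rwa [sub_sub_sub_cancel_right] at this
  have hs1 : HasSum (fun n => crankTail z w (n + 1) * partTail R n -
      crankTail z w (n + 1 + 1) * partTail R (n + 1))
      (crankTail z w 1 * partTail R 0 - 1) := by
    rw [s1.hasSum_iff_tendsto_nat]
    simp only [Finset.sum_range_sub' (fun n => crankTail z w (n + 1) * partTail R n)]
    exact tendsto_const_nhds.sub ht
  have s2 : Summable fun n => crankTail z w (n + 1) * (partTail R n - partTail R (n + 1)) := by
    refine summable_of_X_pow_dvd fun n => Dvd.dvd.mul_left ?_ _
    have := dvd_sub (X_pow_dvd_partTail_sub_one (R := R) n)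
      ((pow_dvd_pow X (Nat.le_succ n)).trans (X_pow_dvd_partTail_sub_one (n + 1)))
    rwa [sub_sub_sub_cancel_right] at this
  rw [tsum_rankTerm, ← sub_sub]
  have h := hs1.sub s2.hasSum
  refine (congrArg (HasSum · _) (funext fun n => ?_)).mp h
  linear_combination partTail R (n + 1) * crankTail_eq_add hzw (Nat.succ_ne_zero n)

end Abel

section Moments

open LaurentPolynomial (T)

lemma floor_two_mul_sub_one_div_two (k : ℕ) : ⌊(((2 * k : ℕ) : ℚ) - 1) / 2⌋ = (k : ℤ) - 1 := by
  rw [Int.floor_eq_iff]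
  push_cast
  constructor <;> linarith

lemma symMoment_two_mul (k : ℕ) (f : ℤ → ℤ) :
    symMoment (2 * k) f = ∑ᶠ m : ℤ, Ring.choose (m + (k - 1)) (2 * k) * f m := by
  rw [symMoment, floor_two_mul_sub_one_div_two]

lemma finite_support_choose_mul_coeff (k : ℕ) (f : ℤ[T;T⁻¹]) :
    (Function.support fun m : ℤ => Ring.choose (m + ((k : ℤ) - 1)) (2 * k) * f.coeff m).Finite :=
  f.coeff.hasFiniteSupport.subset fun m hm h => hm (by simp [h])

/-- The symmetrized moment of order `2k` of the coefficients of a Laurent polynomial. -/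
def laurentMoment (k : ℕ) : ℤ[T;T⁻¹] →+ ℤ where
  toFun f := symMoment (2 * k) fun m => f.coeff m
  map_zero' := by simp [symMoment]
  map_add' f g := by
    simp only [symMoment_two_mul]
    rw [← finsum_add_distrib (finite_support_choose_mul_coeff k f)
      (finite_support_choose_mul_coeff k g)]
    exact finsum_congr fun m => by simp [mul_add]

lemma laurentMoment_T (k : ℕ) (n : ℤ) :
    laurentMoment k (T n) = Ring.choose (n + ((k : ℤ) - 1)) (2 * k) := by
  change symMoment (2 * k) _ = _
  rw [symMoment_two_mul, finsum_eq_single _ n]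
  · simp
  · intro m hm
    simp [hm.symm]

lemma laurentMoment_one (k : ℕ) : laurentMoment (k + 1) 1 = 0 := by
  rw [← LaurentPolynomial.T_zero, laurentMoment_T]
  have h := Ring.choose_natCast (R := ℤ) k (2 * (k + 1))
  rw [Nat.choose_eq_zero_of_lt (by omega)] at h
  simpa using h

lemma laurentMoment_zero_one : laurentMoment 0 1 = 1 := by
  rw [← LaurentPolynomial.T_zero, laurentMoment_T]
  simp

lemma laurentMoment_intCast_mul (k : ℕ) (a : ℤ) (f : ℤ[T;T⁻¹]) :
    laurentMoment k ((a : ℤ[T;T⁻¹]) * f) = a * laurentMoment k f := by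
  rw [← zsmul_eq_mul, map_zsmul, smul_eq_mul]

lemma laurentMoment_ext {φ ψ : ℤ[T;T⁻¹] →+ ℤ} (h : ∀ n, φ (T n) = ψ (T n)) (f : ℤ[T;T⁻¹]) :
    φ f = ψ f := by
  induction f using LaurentPolynomial.induction_on' with
  | add p q hp hq => rw [map_add, map_add, hp, hq]
  | C_mul_T n a =>
    rw [show LaurentPolynomial.C a = ((a : ℤ) : ℤ[T;T⁻¹]) from map_intCast LaurentPolynomial.C a,
      ← zsmul_eq_mul, map_zsmul, map_zsmul, h]

lemma second_difference_mul_T (n : ℤ) :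
    (T 1 + T (-1) - 2) * T n = (T (n + 1) + T (n - 1) - 2 • T n : ℤ[T;T⁻¹]) := by
  rw [sub_eq_add_neg n 1, LaurentPolynomial.T_add, LaurentPolynomial.T_add, two_nsmul]
  ring

lemma laurentMoment_succ_mul (k : ℕ) (f : ℤ[T;T⁻¹]) :
    laurentMoment (k + 1) ((T 1 + T (-1) - 2) * f) = laurentMoment k f := by
  refine laurentMoment_ext
    (φ := (laurentMoment (k + 1)).comp (AddMonoidHom.mulLeft (T 1 + T (-1) - 2))) (fun n => ?_) f
  rw [AddMonoidHom.comp_apply, AddMonoidHom.coe_mulLeft, second_difference_mul_T, map_sub, map_add,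
    map_nsmul]
  simp only [laurentMoment_T]
  have h1 := Ring.choose_succ_succ (n + k) (2 * k + 1)
  have h2 := Ring.choose_succ_succ (n - 1 + k) (2 * k + 1)
  have h3 := Ring.choose_succ_succ (n - 1 + k) (2 * k)
  rw [show n - 1 + (k : ℤ) + 1 = n + k by ring] at h2 h3
  rw [show n + 1 + (((k + 1 : ℕ) : ℤ) - 1) = n + k + 1 by push_cast; ring,
    show n - 1 + (((k + 1 : ℕ) : ℤ) - 1) = n - 1 + k by push_cast; ring,
    show n + (((k + 1 : ℕ) : ℤ) - 1) = n + k by push_cast; ring,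
    show n + ((k : ℤ) - 1) = n - 1 + k by ring, show 2 * (k + 1) = 2 * k + 1 + 1 by ring,
    nsmul_eq_mul]
  push_cast
  linarith

lemma laurentMoment_zero_mul (f : ℤ[T;T⁻¹]) :
    laurentMoment 0 ((T 1 + T (-1) - 2) * f) = 0 := by
  refine laurentMoment_ext (ψ := 0)
    (φ := (laurentMoment 0).comp (AddMonoidHom.mulLeft (T 1 + T (-1) - 2))) (fun n => ?_) f
  rw [AddMonoidHom.comp_apply, AddMonoidHom.coe_mulLeft, second_difference_mul_T, map_sub, map_add,
    map_nsmul]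
  simp [laurentMoment_T]

/-- `laurentMoment` applied to every coefficient of a power series. -/
def seriesMoment (k : ℕ) : ℤ[T;T⁻¹]⟦X⟧ →+ ℤ⟦X⟧ where
  toFun F := PowerSeries.mk fun n => laurentMoment k (coeff n F)
  map_zero' := by ext; simp
  map_add' F G := by ext; simp

@[simp]
lemma coeff_seriesMoment (k n : ℕ) (F : ℤ[T;T⁻¹]⟦X⟧) :
    coeff n (seriesMoment k F) = laurentMoment k (coeff n F) := by
  simp [seriesMoment]

lemma seriesMoment_map_mul (k : ℕ) (g : ℤ⟦X⟧) (F : ℤ[T;T⁻¹]⟦X⟧) :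
    seriesMoment k (PowerSeries.map (Int.castRingHom ℤ[T;T⁻¹]) g * F) = g * seriesMoment k F := by
  ext n
  simp [coeff_mul, laurentMoment_intCast_mul]

lemma seriesMoment_succ_C_mul (k : ℕ) (F : ℤ[T;T⁻¹]⟦X⟧) :
    seriesMoment (k + 1) (C (T 1 + T (-1) - 2) * F) = seriesMoment k F := by
  ext n
  rw [coeff_seriesMoment, coeff_C_mul, laurentMoment_succ_mul, coeff_seriesMoment]

lemma seriesMoment_zero_C_mul (F : ℤ[T;T⁻¹]⟦X⟧) :
    seriesMoment 0 (C (T 1 + T (-1) - 2) * F) = 0 := by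
  ext n
  rw [coeff_seriesMoment, coeff_C_mul, laurentMoment_zero_mul, map_zero]

lemma seriesMoment_succ_one (k : ℕ) : seriesMoment (k + 1) 1 = 0 := by
  ext n
  rw [coeff_seriesMoment, coeff_one]
  split_ifs <;> simp [laurentMoment_one]

lemma seriesMoment_zero_one : seriesMoment 0 1 = 1 := by
  ext n
  rw [coeff_seriesMoment, coeff_one, coeff_one]
  split_ifs <;> simp [laurentMoment_zero_one]

lemma X_pow_dvd_seriesMoment (k : ℕ) {N : ℕ} {F : ℤ[T;T⁻¹]⟦X⟧} (h : X ^ N ∣ F) :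
    X ^ N ∣ seriesMoment k F := by
  rw [X_pow_dvd_iff] at h ⊢
  intro m hm
  rw [coeff_seriesMoment, h m hm, map_zero]

lemma hasSum_seriesMoment [TopologicalSpace ℤ[T;T⁻¹]] [DiscreteTopology ℤ[T;T⁻¹]] (k : ℕ)
    {ι : Type*} {f : ι → ℤ[T;T⁻¹]⟦X⟧} {s : ℤ[T;T⁻¹]⟦X⟧} (h : HasSum f s) :
    HasSum (fun i => seriesMoment k (f i)) (seriesMoment k s) := by
  rw [WithPiTopology.hasSum_iff_hasSum_coeff] at h ⊢
  intro d
  simp only [coeff_seriesMoment]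
  exact (h d).map (laurentMoment k) continuous_of_discreteTopology

lemma map_squareTerm {S : Type*} [CommRing S] (φ : ℤ →+* S) {n : ℕ} (hn : n ≠ 0) :
    PowerSeries.map φ (squareTerm ℤ n) = squareTerm S n := by
  rw [squareTerm, map_mul, map_recip]
  · simp [squareTerm]
  · rw [map_pow, constantCoeff_one_sub (X_dvd_X_pow (by omega)), one_pow]

lemma map_partTail {S : Type*} [CommRing S] (φ : ℤ →+* S) (n : ℕ) :
    PowerSeries.map φ (partTail ℤ n) = partTail S n := by
  rw [partTail, map_mul, map_recip _ (constantCoeff_qPochInf_X_pow (by omega)), map_qPochInf,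
    map_qPochInf]
  simp [partTail]

/-- The symmetrized moment of order `2k` of the tail of the crank product. -/
def tailMoment (k n : ℕ) : ℤ⟦X⟧ :=
  seriesMoment k (crankTail (T 1) (T (-1)) n)

lemma T_one_mul_T_neg_one : (T 1 * T (-1) : ℤ[T;T⁻¹]) = 1 := by
  rw [← LaurentPolynomial.T_add]
  simp

lemma tailMoment_succ (k : ℕ) {n : ℕ} (hn : n ≠ 0) :
    tailMoment (k + 1) n = tailMoment (k + 1) (n + 1) + squareTerm ℤ n * tailMoment k n := by
  rw [tailMoment, crankTail_eq_add T_one_mul_T_neg_one hn, map_add, mul_assoc,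
    seriesMoment_succ_C_mul, ← map_squareTerm (Int.castRingHom _) hn, seriesMoment_map_mul]
  rfl

lemma tailMoment_zero_eq_succ {n : ℕ} (hn : n ≠ 0) : tailMoment 0 n = tailMoment 0 (n + 1) := by
  rw [tailMoment, crankTail_eq_add T_one_mul_T_neg_one hn, map_add, mul_assoc,
    seriesMoment_zero_C_mul, add_zero]
  rfl

lemma tailMoment_zero {n : ℕ} (hn : n ≠ 0) : tailMoment 0 n = 1 := by
  have h : ∀ N, tailMoment 0 n = tailMoment 0 (n + N) := by
    intro N
    induction N with
    | zero => rfl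
    | succ N ih => rw [ih, tailMoment_zero_eq_succ (by omega), add_assoc]
  refine eq_of_X_pow_dvd_sub fun N => ?_
  rw [h N, tailMoment, ← seriesMoment_zero_one, ← map_sub]
  exact X_pow_dvd_seriesMoment 0 ((pow_dvd_pow X (Nat.le_add_left N n)).trans
    (X_pow_dvd_crankTail_sub_one _ _ (by omega)))

lemma X_pow_dvd_tailMoment_succ (k : ℕ) {n : ℕ} (hn : n ≠ 0) : X ^ n ∣ tailMoment (k + 1) n := by
  have h := X_pow_dvd_seriesMoment (k + 1)
    (X_pow_dvd_crankTail_sub_one (T 1 : ℤ[T;T⁻¹]) (T (-1)) hn)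
  rwa [map_sub, seriesMoment_succ_one, sub_zero] at h

lemma X_pow_dvd_squareTerm {R : Type*} [CommRing R] (n : ℕ) : X ^ n ∣ squareTerm R n :=
  Dvd.dvd.mul_right (pow_dvd_pow _ (by omega)) _

lemma hasSum_tailMoment_succ (k : ℕ) {n : ℕ} (hn : n ≠ 0) :
    HasSum (fun m => squareTerm ℤ (n + m) * tailMoment k (n + m)) (tailMoment (k + 1) n) := by
  have hs : Summable fun m => squareTerm ℤ (n + m) * tailMoment k (n + m) :=
    summable_of_X_pow_dvd fun m => Dvd.dvd.mul_right
      ((pow_dvd_pow X (Nat.le_add_left m n)).trans (X_pow_dvd_squareTerm _)) _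
  have hd : ∀ m, squareTerm ℤ (n + m) * tailMoment k (n + m) =
      tailMoment (k + 1) (n + m) - tailMoment (k + 1) (n + (m + 1)) := fun m => by
    rw [tailMoment_succ k (n := n + m) (by omega), add_assoc n m 1]
    ring
  rw [hs.hasSum_iff_tendsto_nat]
  simp only [hd, Finset.sum_range_sub' (fun m => tailMoment (k + 1) (n + m))]
  have ht : Tendsto (fun m => tailMoment (k + 1) (n + m)) atTop (𝓝 0) :=
    tendsto_of_X_pow_dvd fun m => by
      rw [sub_zero]
      exact (pow_dvd_pow X (Nat.le_add_left m n)).trans (X_pow_dvd_tailMoment_succ k (by omega))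
  simpa using tendsto_const_nhds.sub ht

end Moments

section Chains

/-- Weakly increasing `k`-tuples of integers that are at least `n`. -/
abbrev IndexFrom (k n : ℕ) : Type :=
  {v : Fin k → ℕ // Monotone v ∧ ∀ i, n ≤ v i}

/-- Splitting off the first entry of a weakly increasing tuple. -/
def indexFromSuccEquiv (k n : ℕ) : (Σ m : ℕ, IndexFrom k (n + m)) ≃ IndexFrom (k + 1) n where
  toFun p := ⟨Fin.cons (n + p.1) p.2.1, by
    refine ⟨Fin.monotone_iff_le_succ.2 ?_, Fin.cases (Nat.le_add_right _ _) fun i => ?_⟩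
    · intro i
      cases k with
      | zero => exact i.elim0
      | succ k =>
        refine Fin.cases ?_ (fun j => ?_) i
        · simpa using p.2.2.2 0
        · simpa [← Fin.succ_castSucc] using p.2.2.1 (Fin.castSucc_le_succ j)
    · simpa using (Nat.le_add_right _ _).trans (p.2.2.2 i)⟩
  invFun v := ⟨v.1 0 - n, fun i => v.1 i.succ,
    v.2.1.comp (Fin.strictMono_succ.monotone), fun i => by
      rw [Nat.add_sub_cancel' (v.2.2 0)]
      exact v.2.1 (Fin.zero_le _)⟩
  left_inv := by
    rintro ⟨m, v, hv⟩
    have h : n + m - n = m := Nat.add_sub_cancel_left n m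
    simp only [Fin.cons_succ]
    refine Sigma.ext h ?_
    simp only
    congr 1 <;> simp [h]
  right_inv := by
    rintro ⟨v, hv⟩
    refine Subtype.ext (funext fun i => Fin.cases ?_ (fun j => ?_) i)
    · simpa using Nat.add_sub_cancel' (hv.2 0)
    · simp

lemma summable_chain (k n : ℕ) {g : ℕ → ℤ⟦X⟧} (hg : ∀ m, X ^ m ∣ g m) :
    Summable fun v : IndexFrom (k + 1) n => g (v.1 0) * ∏ i : Fin k, squareTerm ℤ (v.1 i.succ) := by
  refine summable_of_finite_not_X_pow_dvd fun N => ?_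
  have hf : {v : Fin (k + 1) → ℕ | ∀ i, v i ∈ Set.Iio N}.Finite := by
    have := Set.Finite.pi' (fun _ : Fin (k + 1) => Set.finite_Iio N)
    simpa using this
  refine (hf.preimage Subtype.val_injective.injOn).subset fun v hv i => ?_
  by_contra hi
  refine hv ?_
  rw [Set.mem_Iio, not_lt] at hi
  revert hi
  refine Fin.cases (fun hi => ?_) (fun j hi => ?_) i
  · exact Dvd.dvd.mul_right ((pow_dvd_pow X hi).trans (hg _)) _
  · exact Dvd.dvd.mul_left (((pow_dvd_pow X hi).trans (X_pow_dvd_squareTerm _)).trans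
      (Finset.dvd_prod_of_mem (fun i : Fin k => squareTerm ℤ (v.1 i.succ)) (Finset.mem_univ j))) _

lemma hasSum_chain_succ (k n : ℕ) {g : ℕ → ℤ⟦X⟧} (hg : ∀ m, X ^ m ∣ g m) {S : ℕ → ℤ⟦X⟧}
    (hS : ∀ m, HasSum (fun v : IndexFrom k (n + m) => ∏ i, squareTerm ℤ (v.1 i)) (S (n + m)))
    {s : ℤ⟦X⟧} (hs : HasSum (fun m => g (n + m) * S (n + m)) s) :
    HasSum (fun v : IndexFrom (k + 1) n => g (v.1 0) * ∏ i : Fin k, squareTerm ℤ (v.1 i.succ))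
      s := by
  have h := (indexFromSuccEquiv k n).hasSum_iff.2 (summable_chain k n hg).hasSum
  have h2 := h.sigma (g := fun m => g (n + m) * S (n + m)) fun m => by
    simpa [indexFromSuccEquiv] using (hS m).mul_left (g (n + m))
  rw [hs.unique h2]
  exact (summable_chain k n hg).hasSum

theorem hasSum_chain (k : ℕ) : ∀ {n : ℕ}, n ≠ 0 →
    HasSum (fun v : IndexFrom k n => ∏ i, squareTerm ℤ (v.1 i)) (tailMoment k n) := by
  induction k with
  | zero =>
    intro n hn
    rw [tailMoment_zero hn]
    let v : IndexFrom 0 n := ⟨Fin.elim0, fun i => i.elim0, fun i => i.elim0⟩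
    have h := hasSum_single (f := fun v : IndexFrom 0 n => ∏ i, squareTerm ℤ (v.1 i)) v
      fun w hw => (hw (Subtype.ext (funext fun i => i.elim0))).elim
    simpa using h
  | succ k ih =>
    intro n hn
    have h := hasSum_chain_succ k n (g := squareTerm ℤ) X_pow_dvd_squareTerm
      (S := tailMoment k) (fun m => ih (by omega)) (hasSum_tailMoment_succ k hn)
    simpa only [Fin.prod_univ_succ] using h

end Chains

section RankSeries

variable {R : Type*} [CommRing R]

open Classical in
/-- The weight whose partition generating function counts the partitions with distinct odd parts
and all parts at most `2L` by their number of parts. -/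
def partWeight (w : R) (L i c : ℕ) : R :=
  if i ≤ 2 * L ∧ (Odd i → c ≤ 1) then w ^ c else 0

lemma largestPart_le_iff {n : ℕ} (p : n.Partition) (N : ℕ) :
    largestPart p ≤ N ↔ ∀ i ∈ p.parts, i ≤ N :=
  Multiset.sup_le

open Classical in
lemma prod_partWeight (w : R) (L : ℕ) {n : ℕ} (p : n.Partition) :
    p.parts.toFinsupp.prod (partWeight w L) =
      if DistinctOddParts p ∧ largestPart p ≤ 2 * L then w ^ Multiset.card p.parts else 0 := by
  simp only [Finsupp.prod, Multiset.toFinsupp_support, Multiset.toFinsupp_apply, partWeight]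
  split_ifs with h
  · rw [← Multiset.toFinset_sum_count_eq p.parts, ← Finset.prod_pow_eq_pow_sum]
    refine Finset.prod_congr rfl fun i hi => if_pos ⟨?_, h.1 i⟩
    exact (largestPart_le_iff p _).1 h.2 i (Multiset.mem_toFinset.1 hi)
  · rw [not_and_or] at h
    obtain h | h := h
    · simp only [DistinctOddParts, not_forall] at h
      obtain ⟨i, hi, hc⟩ := h
      have hm : i ∈ p.parts := Multiset.count_pos.1 (by omega)
      exact Finset.prod_eq_zero (Multiset.mem_toFinset.2 hm) (if_neg fun h => hc (h.2 hi))
    · rw [largestPart_le_iff] at h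
      push Not at h
      obtain ⟨i, hm, hi⟩ := h
      exact Finset.prod_eq_zero (Multiset.mem_toFinset.2 hm) (if_neg fun h => by omega)

/-- The product `(-w q; q^2)_L / (w q^2; q^2)_L`. -/
def boundedPartSeries (w : R) (L : ℕ) : R⟦X⟧ :=
  ∏ j ∈ Finset.range L, ((1 + C w * X ^ (2 * j + 1)) * recip (1 - C w * X ^ (2 * (j + 1))))

lemma tsum_geometric_tail [TopologicalSpace R] [DiscreteTopology R] (w : R) {i : ℕ} (hi : i ≠ 0) :
    1 + ∑' j : ℕ, w ^ (j + 1) • (X : R⟦X⟧) ^ (i * (j + 1)) = recip (1 - C w * X ^ i) := by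
  have h0 : constantCoeff (C w * X ^ i : R⟦X⟧) = 0 := X_dvd_iff.1 (X_dvd_mul_X_pow _ hi)
  have hs := WithPiTopology.summable_pow_of_constantCoeff_eq_zero h0
  rw [recip_eq_of_mul_eq_one (constantCoeff_one_sub (X_dvd_mul_X_pow _ hi))
    (WithPiTopology.one_sub_mul_tsum_pow_of_constantCoeff_eq_zero h0), hs.tsum_eq_zero_add,
    pow_zero]
  refine congrArg _ (tsum_congr fun j => ?_)
  rw [smul_eq_C_mul, mul_pow, ← map_pow, ← pow_mul]

lemma genFun_partWeight (w : R) (L : ℕ) :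
    Nat.Partition.genFun (partWeight w L) = boundedPartSeries w L := by
  let _ : TopologicalSpace R := ⊥
  have _ : DiscreteTopology R := ⟨rfl⟩
  refine (Nat.Partition.hasProd_genFun (partWeight w L)).unique ?_
  have hodd : ∀ j < L, 1 + ∑' c, partWeight w L (2 * j + 1) (c + 1) •
      (X : R⟦X⟧) ^ ((2 * j + 1) * (c + 1)) = 1 + C w * X ^ (2 * j + 1) := by
    intro j hj
    rw [tsum_eq_single 0]
    · rw [partWeight, if_pos ⟨by omega, fun _ => by omega⟩, smul_eq_C_mul]
      simp
    · intro c hc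
      rw [partWeight, if_neg, zero_smul]
      rintro ⟨-, h⟩
      have := h ⟨j, rfl⟩
      omega
  have heven : ∀ j < L, 1 + ∑' c, partWeight w L (2 * j + 1 + 1) (c + 1) •
      (X : R⟦X⟧) ^ ((2 * j + 1 + 1) * (c + 1)) = recip (1 - C w * X ^ (2 * (j + 1))) := by
    intro j hj
    rw [show 2 * (j + 1) = 2 * j + 1 + 1 by ring, ← tsum_geometric_tail w (by omega)]
    refine congrArg _ (tsum_congr fun c => ?_)
    have he : ¬ Odd (2 * j + 1 + 1) := Nat.not_odd_iff_even.2 ⟨j + 1, by ring⟩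
    rw [partWeight, if_pos ⟨by omega, fun h => absurd h he⟩]
  have hbig : ∀ i ∉ Finset.range (2 * L), 1 + ∑' c, partWeight w L (i + 1) (c + 1) •
      (X : R⟦X⟧) ^ ((i + 1) * (c + 1)) = 1 := by
    intro i hi
    rw [Finset.mem_range, not_lt] at hi
    have : ∀ c, partWeight w L (i + 1) (c + 1) • (X : R⟦X⟧) ^ ((i + 1) * (c + 1)) = 0 :=
      fun c => by
        rw [partWeight, if_neg, zero_smul]
        rintro ⟨h, -⟩
        omega
    simp [this]
  have key : ∀ M ≤ L, ∏ i ∈ Finset.range (2 * M), (1 + ∑' c, partWeight w L (i + 1) (c + 1) •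
      (X : R⟦X⟧) ^ ((i + 1) * (c + 1))) = boundedPartSeries w M := by
    intro M
    induction M with
    | zero => simp [boundedPartSeries]
    | succ M ih =>
      intro hM
      rw [show 2 * (M + 1) = 2 * M + 1 + 1 by ring, Finset.prod_range_succ,
        Finset.prod_range_succ, ih (by omega), hodd M (by omega), heven M (by omega),
        boundedPartSeries, boundedPartSeries, Finset.prod_range_succ, mul_assoc]
  rw [← key L le_rfl]
  exact hasProd_prod_of_ne_finset_one hbig

lemma rankTerm_eq_boundedPartSeries_sub {z w : R} (hzw : z * w = 1) (n : ℕ) :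
    rankTerm z w n =
      C (z ^ (n + 1)) * (boundedPartSeries w (n + 1) - boundedPartSeries w n) := by
  have hC : (C z : R⟦X⟧) * C w = 1 := by rw [← map_mul, hzw, map_one]
  have h1 : C (z ^ n) * ∏ j ∈ Finset.range n, (1 + C w * (X : R⟦X⟧) ^ (2 * j + 1)) =
      ∏ j ∈ Finset.range n, (C z + X ^ (2 * j + 1)) := by
    induction n with
    | zero => simp
    | succ n ih =>
      rw [Finset.prod_range_succ, Finset.prod_range_succ, ← ih, pow_succ, map_mul]
      linear_combination (C (z ^ n) * (∏ j ∈ Finset.range n, (1 + C w * (X : R⟦X⟧) ^ (2 * j + 1))) *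
        X ^ (2 * n + 1)) * hC
  have hc : ∀ j : ℕ, constantCoeff (1 - C w * (X : R⟦X⟧) ^ (2 * (j + 1))) = 1 := fun j =>
    constantCoeff_one_sub (X_dvd_mul_X_pow _ (by omega))
  have h2 := mul_recip (hc n)
  rw [rankTerm, boundedPartSeries, boundedPartSeries, Finset.prod_range_succ
    (fun j => (1 + C w * (X : R⟦X⟧) ^ (2 * j + 1)) * recip (1 - C w * X ^ (2 * (j + 1)))),
    Finset.prod_mul_distrib, recip_prod _ hc, Finset.prod_range_succ (fun j => recip _), ← h1,
    pow_succ z n, map_mul]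
  set P := ∏ j ∈ Finset.range n, (1 + C w * (X : R⟦X⟧) ^ (2 * j + 1))
  set Q := ∏ j ∈ Finset.range n, recip (1 - C w * (X : R⟦X⟧) ^ (2 * (j + 1)))
  set r := recip (1 - C w * (X : R⟦X⟧) ^ (2 * (n + 1)))
  linear_combination (-(C (z ^ n) * P * Q * r * (X ^ (2 * n + 1) + X ^ (2 * n + 2)))) * hC -
    (C (z ^ n) * C z * P * Q) * h2

end RankSeries

section Partitions

open LaurentPolynomial (T)

open Classical in
lemma coeff_boundedPartSeries {R : Type*} [CommRing R] (w : R) (L d : ℕ) :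
    coeff d (boundedPartSeries w L) = ∑ p : d.Partition,
      if DistinctOddParts p ∧ largestPart p ≤ 2 * L then w ^ Multiset.card p.parts else 0 := by
  rw [← genFun_partWeight, Nat.Partition.coeff_genFun]
  exact Finset.sum_congr rfl fun p _ => prod_partWeight w L p

lemma m2Rank_eq {d : ℕ} (p : d.Partition) :
    m2Rank p = (((largestPart p + 1) / 2 : ℕ) : ℤ) - Multiset.card p.parts := by
  have h : ⌈(largestPart p : ℚ) / 2⌉ = (((largestPart p + 1) / 2 : ℕ) : ℤ) := by
    rw [Int.ceil_eq_iff]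
    obtain ⟨m, hm | hm⟩ := Nat.even_or_odd' (largestPart p)
    · rw [show (largestPart p + 1) / 2 = m by omega, hm]
      push_cast
      constructor <;> linarith
    · rw [show (largestPart p + 1) / 2 = m + 1 by omega, hm]
      push_cast
      constructor <;> linarith
  rw [m2Rank, h]

open Classical in
lemma coeff_rankTerm (n d : ℕ) :
    coeff d (rankTerm (T 1 : ℤ[T;T⁻¹]) (T (-1)) n) = ∑ p : d.Partition,
      if DistinctOddParts p ∧ (largestPart p + 1) / 2 = n + 1 then T (m2Rank p) else 0 := by
  rw [rankTerm_eq_boundedPartSeries_sub T_one_mul_T_neg_one, coeff_C_mul, map_sub,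
    coeff_boundedPartSeries, coeff_boundedPartSeries, ← Finset.sum_sub_distrib, Finset.mul_sum]
  refine Finset.sum_congr rfl fun p _ => ?_
  by_cases hp : DistinctOddParts p
  · simp only [hp, true_and]
    by_cases h : (largestPart p + 1) / 2 = n + 1
    · rw [if_pos (by omega), if_neg (by omega), if_pos h, m2Rank_eq, h, sub_zero,
        LaurentPolynomial.T_pow, LaurentPolynomial.T_pow, ← LaurentPolynomial.T_add]
      congr 1
      push_cast
      ring
    · rw [if_neg h]
      by_cases h' : largestPart p ≤ 2 * n
      · rw [if_pos (by omega), if_pos h', sub_self, mul_zero]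
      · rw [if_neg (by omega), if_neg h', sub_self, mul_zero]
  · simp [hp]

open Classical in
lemma coeff_one_eq_sum (d : ℕ) :
    coeff d (1 : ℤ[T;T⁻¹]⟦X⟧) = ∑ p : d.Partition,
      if DistinctOddParts p ∧ largestPart p = 0 then T (m2Rank p) else 0 := by
  have h : (1 : ℤ[T;T⁻¹]⟦X⟧) = boundedPartSeries (T (-1)) 0 := by simp [boundedPartSeries]
  rw [h, coeff_boundedPartSeries]
  refine Finset.sum_congr rfl fun p _ => ?_
  simp only [mul_zero, Nat.le_zero]
  refine if_ctx_congr Iff.rfl (fun hp => ?_) fun _ => rfl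
  have hcard : Multiset.card p.parts = 0 := by
    rw [Multiset.card_eq_zero, Multiset.eq_zero_iff_forall_notMem]
    intro i hi
    have h1 := (largestPart_le_iff p 0).1 hp.2.le i hi
    have h2 := p.parts_pos hi
    omega
  rw [m2Rank_eq, hp.2, hcard]
  simp

open Classical in
/-- The generating function of the partitions with distinct odd parts by `M_2`-rank. -/
theorem coeff_rankSeries [TopologicalSpace ℤ[T;T⁻¹]] [DiscreteTopology ℤ[T;T⁻¹]] (d : ℕ) :
    coeff d (1 + ∑' n, rankTerm (T 1 : ℤ[T;T⁻¹]) (T (-1)) n) = ∑ p : d.Partition,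
      if DistinctOddParts p then T (m2Rank p) else 0 := by
  have hs : Summable (rankTerm (T 1 : ℤ[T;T⁻¹]) (T (-1))) := summable_of_X_pow_dvd fun n => by
    rw [rankTerm, mul_assoc, mul_assoc]
    exact Dvd.dvd.mul_right (pow_dvd_pow _ (by omega)) _
  have h1 := (WithPiTopology.hasSum_iff_hasSum_coeff _).1 hs.hasSum d
  simp only [coeff_rankTerm] at h1
  have h2 : HasSum (fun n : ℕ => ∑ p : d.Partition,
      if DistinctOddParts p ∧ (largestPart p + 1) / 2 = n + 1 then (T (m2Rank p) : ℤ[T;T⁻¹]) else 0)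
      (∑ p : d.Partition,
        if DistinctOddParts p ∧ largestPart p ≠ 0 then (T (m2Rank p) : ℤ[T;T⁻¹]) else 0) := by
    refine hasSum_sum fun p _ => ?_
    have h := hasSum_single (f := fun n : ℕ => if DistinctOddParts p ∧
      (largestPart p + 1) / 2 = n + 1 then (T (m2Rank p) : ℤ[T;T⁻¹]) else 0)
      ((largestPart p + 1) / 2 - 1) fun n hn => if_neg fun h => hn (by omega)
    convert h using 1
    refine if_congr (and_congr_right fun _ => ?_) rfl rfl
    omega
  rw [map_add, h1.unique h2, coeff_one_eq_sum, ← Finset.sum_add_distrib]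
  refine Finset.sum_congr rfl fun p _ => ?_
  by_cases hp : DistinctOddParts p <;> by_cases hl : largestPart p = 0 <;> simp [hp, hl]

lemma coeff_coeff_rankSeries [TopologicalSpace ℤ[T;T⁻¹]] [DiscreteTopology ℤ[T;T⁻¹]] (m : ℤ)
    (d : ℕ) :
    (coeff d (1 + ∑' n, rankTerm (T 1 : ℤ[T;T⁻¹]) (T (-1)) n)).coeff m = N2 m d := by
  classical
  rw [coeff_rankSeries, N2, Nat.card_eq_fintype_card, Fintype.card_subtype]
  rw [Finset.card_filter]
  push_cast
  rw [show ∀ (s : Finset d.Partition) (f : d.Partition → ℤ[T;T⁻¹]),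
    (∑ p ∈ s, f p).coeff m = ∑ p ∈ s, (f p).coeff m from fun s f => by simp]
  refine Finset.sum_congr rfl fun p _ => ?_
  by_cases hp : DistinctOddParts p <;> simp [hp]

end Partitions

section NonnegativeCoefficients

/-- The power series with nonnegative integer coefficients. -/
def nonnegSeries : Subsemiring ℤ⟦X⟧ where
  carrier := {f | ∀ n, 0 ≤ coeff n f}
  mul_mem' hf hg n := by
    rw [coeff_mul]
    exact Finset.sum_nonneg fun p _ => mul_nonneg (hf _) (hg _)
  one_mem' n := by
    rw [coeff_one]
    split_ifs <;> simp
  add_mem' hf hg n := by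
    rw [map_add]
    exact add_nonneg (hf n) (hg n)
  zero_mem' n := by simp

lemma X_mem_nonnegSeries : (X : ℤ⟦X⟧) ∈ nonnegSeries := fun n => by
  rw [coeff_X]
  split_ifs <;> simp

lemma isClosed_nonnegSeries : IsClosed (nonnegSeries : Set ℤ⟦X⟧) := by
  change IsClosed {f : ℤ⟦X⟧ | ∀ n, 0 ≤ coeff n f}
  simp only [Set.ofPred_forall]
  exact isClosed_iInter fun n => isClosed_Ici.preimage (WithPiTopology.continuous_coeff ℤ n)

lemma recip_one_sub_X_pow_mem {n : ℕ} (hn : n ≠ 0) : recip (1 - X ^ n) ∈ nonnegSeries := by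
  have h0 : constantCoeff (X ^ n : ℤ⟦X⟧) = 0 := X_dvd_iff.1 (X_dvd_X_pow hn)
  rw [recip_eq_of_mul_eq_one (constantCoeff_one_sub (X_dvd_X_pow hn))
    (WithPiTopology.one_sub_mul_tsum_pow_of_constantCoeff_eq_zero h0)]
  exact isClosed_nonnegSeries.mem_of_tendsto
    (WithPiTopology.summable_pow_of_constantCoeff_eq_zero h0).hasSum
    (Eventually.of_forall fun s => sum_mem fun i _ => pow_mem (pow_mem X_mem_nonnegSeries _) _)

lemma squareTerm_mem {n : ℕ} (hn : n ≠ 0) : squareTerm ℤ n ∈ nonnegSeries := by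
  have hc : constantCoeff (1 - X ^ (2 * n) : ℤ⟦X⟧) = 1 :=
    constantCoeff_one_sub (X_dvd_X_pow (by omega))
  have := recip_one_sub_X_pow_mem (n := 2 * n) (by omega)
  rw [squareTerm, sq, recip_mul hc hc]
  exact mul_mem (pow_mem X_mem_nonnegSeries _) (mul_mem this this)

lemma qPochInf_neg_X_pow_mem (n : ℕ) : qPochInf (-X ^ n) ∈ nonnegSeries :=
  isClosed_nonnegSeries.mem_of_tendsto (hasProd_qPochInf _) <| Eventually.of_forall fun s =>
    prod_mem fun j _ => by
      rw [neg_mul, sub_neg_eq_add]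
      exact add_mem (one_mem _) (mul_mem (pow_mem X_mem_nonnegSeries _)
        (pow_mem X_mem_nonnegSeries _))

lemma recip_qPochInf_X_pow_mem {n : ℕ} (hn : n ≠ 0) :
    recip (qPochInf (X ^ n)) ∈ nonnegSeries := by
  have hd : ∀ N : ℕ, X ^ N ∣ recip (∏ j ∈ Finset.range N, (1 - (X : ℤ⟦X⟧) ^ n * X ^ (2 * j))) -
      recip (qPochInf (X ^ n)) := by
    intro N
    rw [qPochInf_eq_prod_mul _ N, recip_mul
      (constantCoeff_prod_one_sub _ fun j => Dvd.dvd.mul_right (X_dvd_X_pow hn) _)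
      (constantCoeff_qPochInf (Dvd.dvd.mul_right (X_dvd_X_pow hn) _)), ← mul_one_sub]
    refine Dvd.dvd.mul_left ?_ _
    rw [← dvd_neg, neg_sub]
    exact X_pow_dvd_recip_sub_one (constantCoeff_qPochInf (Dvd.dvd.mul_right (X_dvd_X_pow hn) _))
      (X_pow_dvd_qPochInf_sub_one (Dvd.dvd.mul_left (pow_dvd_pow _ (by omega)) _))
  refine isClosed_nonnegSeries.mem_of_tendsto (tendsto_of_X_pow_dvd hd)
    (Eventually.of_forall fun N => ?_)
  rw [recip_prod _ fun j => constantCoeff_one_sub (Dvd.dvd.mul_right (X_dvd_X_pow hn) _)]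
  refine prod_mem fun j _ => ?_
  rw [← pow_add]
  exact recip_one_sub_X_pow_mem (by omega)

lemma partTail_mem (n : ℕ) : partTail ℤ n ∈ nonnegSeries :=
  mul_mem (qPochInf_neg_X_pow_mem _) (recip_qPochInf_X_pow_mem (by omega))

end NonnegativeCoefficients

section Main

open LaurentPolynomial (T)

lemma crankSeries_eq :
    crankSeries = crankTail (T 1 : ℤ[T;T⁻¹]) (T (-1)) 1 * partTail ℤ[T;T⁻¹] 0 := by
  have h := mul_recip (constantCoeff_qPochInf_X_pow (R := ℤ[T;T⁻¹]) (n := 2) (by omega))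
  rw [crankSeries, crankTail, partTail]
  simp only [mul_zero, zero_add, pow_one, mul_one]
  linear_combination (-(qPochInf (-X) * qPochInf (X ^ 2) *
    recip (qPochInf (PowerSeries.C (T 1 : ℤ[T;T⁻¹]) * X ^ 2)) *
    recip (qPochInf (PowerSeries.C (T (-1)) * X ^ 2)))) * h

lemma summand_eq {k : ℕ} (hk : 1 ≤ k + 1) (v : Index (k + 1)) :
    summand hk v = squareTerm ℤ (v.1 0) * partTail ℤ (v.1 0) *
      ∏ i : Fin k, squareTerm ℤ (v.1 i.succ) := by
  have h : X ^ (2 * ∑ i, v.1 i) * recip (∏ i, (1 - X ^ (2 * v.1 i)) ^ 2) =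
      ∏ i, squareTerm ℤ (v.1 i) := by
    rw [recip_prod]
    · simp only [squareTerm, Finset.prod_mul_distrib, Finset.mul_sum, Finset.prod_pow_eq_pow_sum]
    · intro i
      have := v.2.2 i
      rw [map_pow, constantCoeff_one_sub (X_dvd_X_pow (by omega)), one_pow]
  rw [summand, h, Fin.prod_univ_succ, partTail]
  change _ * qPochInf (-X ^ (2 * v.1 0 + 1)) * recip (qPochInf (X ^ (2 * v.1 0 + 2))) = _
  ring

theorem hasSum_summand (k : ℕ) (hk : 1 ≤ k + 1) :
    HasSum (fun v : Index (k + 1) => summand hk v) (PowerSeries.mk (M2spt (k + 1))) := by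
  let _ : TopologicalSpace ℤ[T;T⁻¹] := ⊥
  have _ : DiscreteTopology ℤ[T;T⁻¹] := ⟨rfl⟩
  have h := hasSum_seriesMoment (k + 1)
    (hasSum_crank_sub_rank (R := ℤ[T;T⁻¹]) T_one_mul_T_neg_one)
  have hv : seriesMoment (k + 1) (crankTail (T 1) (T (-1)) 1 * partTail ℤ[T;T⁻¹] 0 -
      (1 + ∑' n, rankTerm (T 1) (T (-1)) n)) = PowerSeries.mk (M2spt (k + 1)) := by
    ext n
    rw [← crankSeries_eq, map_sub, map_sub, coeff_seriesMoment, coeff_seriesMoment, coeff_mk]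
    refine congrArg (laurentMoment (k + 1) (coeff n crankSeries) - ·) ?_
    exact congrArg (symMoment _) (funext fun m => coeff_coeff_rankSeries m n)
  rw [hv] at h
  have ht : ∀ n, seriesMoment (k + 1) (C (T 1 + T (-1) - 2) * squareTerm ℤ[T;T⁻¹] (n + 1) *
      crankTail (T 1) (T (-1)) (n + 1) * partTail ℤ[T;T⁻¹] (n + 1)) =
      squareTerm ℤ (1 + n) * partTail ℤ (1 + n) * tailMoment k (1 + n) := by
    intro n
    rw [add_comm n 1, mul_right_comm, mul_assoc, mul_assoc, seriesMoment_succ_C_mul, ← mul_assoc,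
      ← map_squareTerm (Int.castRingHom _) (by omega), ← map_partTail (Int.castRingHom _),
      ← map_mul, seriesMoment_map_mul]
    rfl
  simp only [ht] at h
  simp only [summand_eq]
  exact hasSum_chain_succ k 1 (g := fun m => squareTerm ℤ m * partTail ℤ m)
    (fun m => Dvd.dvd.mul_right (X_pow_dvd_squareTerm m) _) (S := tailMoment k)
    (fun m => hasSum_chain k (by omega)) h

lemma summand_mem_nonnegSeries {k : ℕ} (hk : 1 ≤ k + 1) (v : Index (k + 1)) :
    summand hk v ∈ nonnegSeries := by
  have h : ∀ i, v.1 i ≠ 0 := fun i => Nat.one_le_iff_ne_zero.1 (v.2.2 i)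
  rw [summand_eq]
  exact mul_mem (mul_mem (squareTerm_mem (h 0)) (partTail_mem _))
    (prod_mem fun i _ => squareTerm_mem (h _))

lemma M2spt_zero (k : ℕ) : M2spt (k + 1) 0 = 0 := by
  have h := X_pow_dvd_of_hasSum (N := 1) (hasSum_summand k (Nat.le_add_left 1 k)) fun v => by
    rw [summand_eq]
    exact Dvd.dvd.mul_right (Dvd.dvd.mul_right
      ((pow_dvd_pow X (v.2.2 0)).trans (X_pow_dvd_squareTerm _)) _) _
  simpa using X_pow_dvd_iff.1 h 0 one_pos

end Main

end M2Spt

end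

/-- For every `k ≥ 1`, as formal power series over `ℤ` (convergence is coefficientwise),
`∑_{n ≥ 1} M2spt_k(n) q^n` is the sum of the summands over all `n_k ≥ ⋯ ≥ n_1 ≥ 1`; and
`M2spt_k(n)` is never negative. -/
theorem mainTheorem3 (k : ℕ) (hk : 1 ≤ k) :
    HasSum (fun v : M2Spt.Index k => M2Spt.summand hk v)
      (PowerSeries.mk fun n => if n = 0 then 0 else M2Spt.M2spt k n) ∧
    ∀ n : ℕ, 0 ≤ M2Spt.M2spt k n := by
  obtain ⟨k, rfl⟩ := Nat.exists_eq_add_of_le' hk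
  have h := M2Spt.hasSum_summand k hk
  have hf : (fun n => if n = 0 then 0 else M2Spt.M2spt (k + 1) n) = M2Spt.M2spt (k + 1) := by
    funext n
    split_ifs with hn
    · rw [hn, M2Spt.M2spt_zero]
    · rfl
  refine ⟨by rw [hf]; exact h, fun n => ?_⟩
  have hn := M2Spt.isClosed_nonnegSeries.mem_of_tendsto h (Filter.Eventually.of_forall fun s =>
    sum_mem fun v _ => M2Spt.summand_mem_nonnegSeries hk v) n
  simpa using hn
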